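/- Let $\mathbb{K}$ be an algebraically closed field of any characteristic, and let $P(x,y,T)=p(x,y)-T\,x^cU(x,y)$ be a special pencil: $p,U\in\mathbb{K}[[x,y]]$, $c>0$, $U$ is a unit and $x\nmid p$. *The toric-Newton process.* Starting from $P$, the following two transformations are applied repeatedly; each of them leads to a pencil of the same form. Let $\ell$ be a compact edge of the Newton polygon of the current pencil $P=\sum A_{i,j}x^iy^j$ over $\mathbb{K}(T)$, on the line $ni+mj=\omega$ with $n,m>0$ coprime. The part of $P$ on $\ell$ is $P_\ell=x^uy^vq_\ell(x^m,y^n)$, where $q_\ell(s_1,s_2)$ is homogeneous and coprime with $s_1s_2$. The edge is dicritical if its lower right vertex is $(c,0)$. (a) If $n=1$ and $P_\ell$ is proportional to $(y-Bx^m)^e$ with $B\in\mathbb{K}$, translate: $y=y_1+Bx^m$. (b) If $\ell$ is neither dicritical nor as in (a), and $\alpha\in\mathbb{K}$ is a root of $q_\ell(1,s)$, substitute $x=x_1^n(y_1+\alpha)^a$, $y=x_1^m(y_1+\alpha)^b$ with $a,b>0$, $bn-am=1$, and divide by $x_1^{\omega}(y_1+\alpha)^{\tilde v}$, where $\tilde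 v$ is the minimum of $ai+bj$ on the support of $P$. *The dicritical divisor.* Let $\ell$ be a dicritical edge of some pencil $P_k=p_k-Tx^{c_k}U_k$ of this process, with weights $(n,m)$, and let $E\cong\mathbb{P}^1$ be the exceptional divisor of the toric transformation with weights $(n,m)$, with coordinate $z=y^n/x^m$. Let $q_E(z)\in\mathbb{K}[z]$ be the restriction to $E$ of $p_k/(x^{c_k}U_k)$. Thus $q_E(z)=U_k(0,0)^{-1}\,q_\ell(1,z)|_{T=0}$, and $q_E$ is a polynomial; let $d_E=\deg q_E$. Put $A_E^*=\{q_E(\alpha): q_E'(\alpha)=0\}$. Local coordinates $(x_1,y_1)$ at the point $z=\alpha$ of $E=\{x_1=0\}$ are given for $\alpha\neq0$ by $x=x_1^n(y_1+\alpha)^a$, $y=x_1^m(y_1+\alpha)^b$ with $a,b>0$, $bn-am=1$, and for $\alpha=0$, $n=1$ by $x=x_1$, $y=x_1^my_1$. At $z=\infty$, and at $z=0$ if $n>1$, the divisor $E$ crosses another divisor of the toric modification given by a regular subdivision of the fan of the Newton polygon of $P_k$; the local coordinates there are given by $x=x_1^ny_1^{a}$, $y=x_1^my_1^{b}$, where $(n,m),(a,b)$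 span a cone of that subdivision. The strict transform of a curve at a point is its total transform divided by the highest powers of the local equations of these divisors. **Proposition.** Assume that $q_E$ is separable, that is, $q_E'\not\equiv0$. Let $t\in\mathbb{K}$ be such that either (1) $t\notin A_E^*$ and $t\neq q_E(0)$; or (2) $t=q_E(0)$, $t\notin A_E^*$ and $n=1$. Then the strict transform of the germ $p(x,y)-t\,x^cU(x,y)=0$ (with $p,c,U$ those of the initial pencil) contains exactly $d_E$ non-singular curvettes transversal to $E$, and they meet $E$ at $d_E$ distinct points. More precisely, there is a set $S$ of exactly $d_E$ points $z=\alpha$, $\alpha\in\mathbb{K}$, of $E$, with $\alpha\neq0$ if $n>1$, such that at each point of $S$ the strict transform is one non-singular germ transversal to $E$, and the strict transform passes through no other point of $E$, the points $z=0$ and $z=\infty$ included. -/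

import Mathlib

noncomputable section

namespace ToricNewton

/-- The exponent of the monomial `x ^ i * y ^ j`. -/
def mon (i j : ℕ) : Fin 2 →₀ ℕ := Finsupp.single 0 i + Finsupp.single 1 j

/-- Formal power series in two variables; the variable of index `0` is `x` (or `x₁`), the variable
of index `1` is `y` (or `y₁`). -/
abbrev Ser (R : Type*) [CommRing R] := MvPowerSeries (Fin 2) R

/-- The data of a pencil `p - T * x ^ c * U`. -/
structure Pencil (K : Type*) [Field K] where
  p : Ser K
  c : ℕ
  U : Ser K

namespace Pencil

variable {K : Type*} [Field K]

/-- `p - T * x ^ c * U` is special: `c > 0`, `U` is a unit and `x` does not divide `p`. -/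
def IsSpecial (P : Pencil K) : Prop :=
  0 < P.c ∧ IsUnit P.U ∧ ¬ (MvPowerSeries.X 0 ∣ P.p)

/-- The series `P(x, y, T) = p - T * x ^ c * U`, with coefficients in `K[T]`. -/
def series (P : Pencil K) : Ser (Polynomial K) :=
  MvPowerSeries.map Polynomial.C P.p -
    MvPowerSeries.C Polynomial.X *
      MvPowerSeries.map Polynomial.C (MvPowerSeries.X 0 ^ P.c * P.U)

/-- The coefficient `A i j` in `K[T]` of `x ^ i * y ^ j` in `P(x, y, T)`. -/
def A (P : Pencil K) (i j : ℕ) : Polynomial K := MvPowerSeries.coeff (mon i j) P.series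

/-- The equation `p - t * x ^ c * U` of the member of the pencil with parameter `t`. -/
def fiber (P : Pencil K) (t : K) : Ser K :=
  P.p - MvPowerSeries.C t * (MvPowerSeries.X 0 ^ P.c * P.U)

/-- The point `(i₀, j₀)` of the support has the least weight `n * i + m * j` in the support. -/
def IsMinimal (P : Pencil K) (n m i₀ j₀ : ℕ) : Prop :=
  P.A i₀ j₀ ≠ 0 ∧ ∀ i j, P.A i j ≠ 0 → n * i₀ + m * j₀ ≤ n * i + m * j

/-- The Newton polygon of `P(x, y, T)` has a compact edge on a line `n * i + m * j = ω`, with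
`n`, `m` positive and coprime, and the lower right vertex of this edge is `(i₀, j₀)`. -/
def IsEdge (P : Pencil K) (n m i₀ j₀ : ℕ) : Prop :=
  0 < n ∧ 0 < m ∧ Nat.Coprime n m ∧ P.IsMinimal n m i₀ j₀ ∧
    (∀ i j, P.A i j ≠ 0 → n * i + m * j = n * i₀ + m * j₀ → j₀ ≤ j) ∧
    ∃ i j, P.A i j ≠ 0 ∧ n * i + m * j = n * i₀ + m * j₀ ∧ (i, j) ≠ (i₀, j₀)

/-- The polynomial `q(1, s)` of the edge with weights `n`, `m` and lower right vertex `(i₀, j₀)`: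
the sum of the terms of `P(x, y, T)` on the edge is `x ^ u * y ^ j₀ * q(x ^ m, y ^ n)` with `q`
homogeneous and prime to both of its variables. -/
def edgePoly (P : Pencil K) (n m i₀ j₀ : ℕ) : Polynomial (Polynomial K) :=
  ∑ k ∈ Finset.range (i₀ / m + 1),
    Polynomial.C (P.A (i₀ - m * k) (j₀ + n * k)) * Polynomial.X ^ k

/-- The sum of the terms of `P(x, y, T)` on the edge is proportional to
`(y - B * x ^ m) ^ e` with `B` in `K`, and `n = 1`. -/
def IsPurePower (P : Pencil K) (n m i₀ j₀ : ℕ) (B : K) (e : ℕ) : Prop :=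
  n = 1 ∧ j₀ = 0 ∧ i₀ = m * e ∧
    ∃ β : Polynomial K, P.edgePoly n m i₀ j₀ =
      Polynomial.C β * (Polynomial.X - Polynomial.C (Polynomial.C B)) ^ e

/-- The least value of `a * i + b * j` on the support of `P(x, y, T)`. -/
def minWeight (P : Pencil K) (a b : ℕ) : ℕ :=
  sInf {w | ∃ i j, P.A i j ≠ 0 ∧ w = a * i + b * j}

end Pencil

variable {K : Type*} [Field K]

/-- The substitution `x = x₁ ^ n * (y₁ + α) ^ a`, `y = x₁ ^ m * (y₁ + α) ^ b`. -/
def toricChart (n m a b : ℕ) (α : K) : Fin 2 → Ser K :=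
  ![MvPowerSeries.X 0 ^ n * (MvPowerSeries.X 1 + MvPowerSeries.C α) ^ a,
    MvPowerSeries.X 0 ^ m * (MvPowerSeries.X 1 + MvPowerSeries.C α) ^ b]

/-- The substitution `x = x₁`, `y = y₁ + B * x₁ ^ m`. -/
def translation (m : ℕ) (B : K) : Fin 2 → Ser K :=
  ![MvPowerSeries.X 0, MvPowerSeries.X 1 + MvPowerSeries.C B * MvPowerSeries.X 0 ^ m]

/-- `P'` is the strict transform of `P` by the toric-Newton transformation with exponents
`n`, `m`, `a`, `b` and translation by `α`, for the edge with lower right vertex `(i₀, j₀)`: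
`P(x₁ ^ n * (y₁ + α) ^ a, x₁ ^ m * (y₁ + α) ^ b, T) = x₁ ^ ω * (y₁ + α) ^ v * P'(x₁, y₁, T)`,
written out for the coefficients of `1` and of `T`. -/
def IsPencilTransform (P P' : Pencil K) (n m a b i₀ j₀ : ℕ) (α : K) : Prop :=
  MvPowerSeries.subst (toricChart n m a b α) P.p =
      MvPowerSeries.X 0 ^ (n * i₀ + m * j₀) *
        (MvPowerSeries.X 1 + MvPowerSeries.C α) ^ P.minWeight a b * P'.p ∧
    MvPowerSeries.subst (toricChart n m a b α) (MvPowerSeries.X 0 ^ P.c * P.U) =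
      MvPowerSeries.X 0 ^ (n * i₀ + m * j₀) *
        (MvPowerSeries.X 1 + MvPowerSeries.C α) ^ P.minWeight a b *
          (MvPowerSeries.X 0 ^ P'.c * P'.U) ∧
    P'.c + (n * i₀ + m * j₀) = n * P.c

/-- The toric-Newton process of the pencil `P₀`. `Reaches P₀ P π` says that the process leads
from `P₀` to the pencil `P`, and that `π` is the pull-back of series by the composite of the
transformations made on the way. -/
inductive Reaches (P₀ : Pencil K) : Pencil K → (Ser K → Ser K) → Prop
  | start : Reaches P₀ P₀ id
  /-- If the part of `P` on an edge is proportional to `(y - B * x ^ m) ^ e`, translate. -/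
  | translate {P : Pencil K} {π : Ser K → Ser K} (h : Reaches P₀ P π)
      (n m i₀ j₀ e : ℕ) (B : K) (hedge : P.IsEdge n m i₀ j₀)
      (hpure : P.IsPurePower n m i₀ j₀ B e) :
      Reaches P₀
        ⟨MvPowerSeries.subst (translation m B) P.p, P.c,
          MvPowerSeries.subst (translation m B) P.U⟩
        (fun f => MvPowerSeries.subst (translation m B) (π f))
  /-- For a non-dicritical edge which is not as above, and a root `α` of its polynomial, make the
  toric-Newton transformation. -/
  | toric {P P' : Pencil K} {π : Ser K → Ser K} (h : Reaches P₀ P π)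
      (n m i₀ j₀ a b : ℕ) (α : K) (hedge : P.IsEdge n m i₀ j₀)
      (hdic : (i₀, j₀) ≠ (P.c, 0))
      (hpure : ∀ (B : K) (e : ℕ), ¬ P.IsPurePower n m i₀ j₀ B e)
      (ha : 0 < a) (hb : 0 < b) (hab : b * n = a * m + 1)
      (hroot : (P.edgePoly n m i₀ j₀).eval (Polynomial.C α) = 0)
      (htransform : IsPencilTransform P P' n m a b i₀ j₀ α) :
      Reaches P₀ P' (fun f => MvPowerSeries.subst (toricChart n m a b α) (π f))

/-- A dicritical divisor of the pencil `P₀`, given by a dicritical edge of the toric-Newton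
process: an edge, with v-ratio `n` and h-ratio `m`, of the Newton polygon of some pencil `P`
of the process, whose lower right vertex is `(P.c, 0)`. The divisor is created by the toric
transformation with weights `(n, m)`. It is a projective line with
coordinate `z = y ^ n / x ^ m`, where `x`, `y` are the variables of `P`. -/
structure Dicritical (P₀ : Pencil K) where
  P : Pencil K
  π : Ser K → Ser K
  process : Reaches P₀ P π
  n : ℕ
  m : ℕ
  isEdge : P.IsEdge n m P.c 0

namespace Dicritical

variable {P₀ : Pencil K}

/-- The polynomial `q_E`, that is, the restriction to `E` of the meromorphic function
`p / (x ^ c * U)`. It is the polynomial of the edge without its term in `T`, divided by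
`U(0, 0)`. -/
def q (E : Dicritical P₀) : Polynomial K :=
  Polynomial.C (MvPowerSeries.constantCoeff E.P.U)⁻¹ *
    (E.P.edgePoly E.n E.m E.P.c 0).map (Polynomial.evalRingHom 0)

/-- The set of critical values of `q_E`. -/
def criticalValues (E : Dicritical P₀) : Set K :=
  {t | ∃ α, E.q.derivative.eval α = 0 ∧ E.q.eval α = t}

/-- Local coordinates `x₁`, `y₁` at the point `z = α` of `E`, in which `E` is `x₁ = 0`. At a
point `α ≠ 0` they are given by the toric map with `b * n = a * m + 1`, followed by the
translation by `α`. At the point `α = 0`, which is used only if `n = 1`, they are given by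
`x = x₁`, `y = x₁ ^ m * y₁`. -/
def chart (E : Dicritical P₀) (a b : ℕ) (α : K) : Fin 2 → Ser K :=
  open Classical in
  if α = 0 then toricChart E.n E.m 0 1 0 else toricChart E.n E.m a b α

/-- `g` is a local equation, at the point `z = α` of `E`, of the strict transform of the curve
`f = 0`. -/
def IsStrictTransform (E : Dicritical P₀) (a b : ℕ) (α : K) (f g : Ser K) : Prop :=
  ∃ N : ℕ, MvPowerSeries.subst (E.chart a b α) (E.π f) = MvPowerSeries.X 0 ^ N * g ∧
    ¬ (MvPowerSeries.X 0 ∣ g)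

/-- The vectors `(n, m)` and `(a, b)` span a regular cone on which some point of the support
is minimal for all weights (that is, a cone of a regular subdivision of the fan of the Newton
polygon). Then `E` and the divisor with weights `(a, b)` cross at the point
`z = 0` of `E` if `b * n = a * m + 1`, and at the point `z = ∞` if `a * m = b * n + 1`. If `n = 1`,
then `z = 0` is an ordinary point of `E`, so that the former case is left out. -/
def IsCorner (E : Dicritical P₀) (a b : ℕ) : Prop :=
  ((E.n ≠ 1 ∧ b * E.n = a * E.m + 1) ∨ a * E.m = b * E.n + 1) ∧
    ∃ i j, E.P.IsMinimal E.n E.m i j ∧ E.P.IsMinimal a b i j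

/-- `g` is a local equation of the strict transform of the curve `f = 0` at the point where `E`
crosses the divisor with weights `(a, b)`. The local coordinates are given by
`x = x₁ ^ n * y₁ ^ a`, `y = x₁ ^ m * y₁ ^ b`, and the divisors are `x₁ = 0` and `y₁ = 0`. -/
def IsCornerTransform (E : Dicritical P₀) (a b : ℕ) (f g : Ser K) : Prop :=
  ∃ N M : ℕ, MvPowerSeries.subst (toricChart E.n E.m a b (0 : K)) (E.π f) =
      MvPowerSeries.X 0 ^ N * MvPowerSeries.X 1 ^ M * g ∧
    ¬ (MvPowerSeries.X 0 ∣ g) ∧ ¬ (MvPowerSeries.X 1 ∣ g)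

end Dicritical

/-- The germ `g = 0` passes through the origin and is non-singular there. -/
def IsNonsingular (g : Ser K) : Prop :=
  MvPowerSeries.constantCoeff g = 0 ∧
    (MvPowerSeries.coeff (mon 1 0) g ≠ 0 ∨ MvPowerSeries.coeff (mon 0 1) g ≠ 0)

/-- The germ `g = 0` is non-singular and transversal to the line `x₁ = 0`. -/
def IsCurvette (g : Ser K) : Prop :=
  IsNonsingular g ∧ MvPowerSeries.coeff (mon 0 1) g ≠ 0

end ToricNewton

end

namespace ToricNewton

open MvPowerSeries

variable {K : Type*} [Field K]

/-! Each transformation of the process is a substitution. It carries the member with parameter `t`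
to a power of `x₁` times a unit times the same member of the new pencil (`Reaches.fiber_eq`), so
only the last pencil, the one with the dicritical edge, matters. There the terms of least weight `n
* c` are those on the edge, and `T` occurs on it only at the vertex `(c, 0)`. At the point `z = α`,
the member therefore becomes a power of `x₁` times `v * (q_E(y₁ + α) - t) + x₁ * h` with `v` a unit
(`Dicritical.subst_chart_fiber_eq`). It misses the point if `q_E(α) ≠ t`. If `q_E(α) = t`, its
coefficient of `y₁` is `v(0) * q_E'(α)`, which is nonzero for noncritical `t`. At a corner the
pull-back is a monomial times a unit as soon as the vertex shared by both weights survives in the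
member. At `z = ∞` this vertex has abscissa less than `c`, where `T` is absent; at `z = 0` it is
`(c, 0)`, with coefficient `U(0,0) * (q_E(0) - t)`. The set `S` is the set of roots of `q_E - t`,
all simple. -/

@[simp] theorem mon_zero (i j : ℕ) : mon i j 0 = i := by simp [mon]

@[simp] theorem mon_one (i j : ℕ) : mon i j 1 = j := by simp [mon]

theorem mon_eta (d : Fin 2 →₀ ℕ) : mon (d 0) (d 1) = d := by
  ext s; fin_cases s <;> simp

theorem coeff_eq_zero_of_X_pow_dvd {f : Ser K} {s : Fin 2} {N : ℕ} (h : X s ^ N ∣ f)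
    (d : Fin 2 →₀ ℕ) (hd : d s < N) : coeff d f = 0 :=
  X_pow_dvd_iff.1 h d hd

theorem coeff_mon_zero_one_mul (u g : Ser K) (hg : constantCoeff g = 0) :
    coeff (mon 0 1) (u * g) = constantCoeff u * coeff (mon 0 1) g := by
  classical
  have h : mon 0 1 = Finsupp.single 1 1 := by simp [mon]
  rw [h, coeff_mul, Finsupp.antidiagonal_single, Finset.sum_map]
  simp [Finset.Nat.antidiagonal_succ, hg]

theorem not_X_dvd_of_constantCoeff_ne_zero {g : Ser K} (h : constantCoeff g ≠ 0) (s : Fin 2) :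
    ¬ X s ∣ g := by
  rintro ⟨k, rfl⟩
  simp at h

theorem not_X_zero_dvd_of_coeff_ne_zero {g : Ser K} (h : coeff (mon 0 1) g ≠ 0) :
    ¬ X 0 ∣ g := fun hd => h (X_dvd_iff.1 hd _ (by simp))

/-! ### Toric substitutions in power series -/

theorem hasSubst_toricChart {n m : ℕ} (hn : 0 < n) (hm : 0 < m) (a b : ℕ) (α : K) :
    HasSubst (toricChart n m a b α) := by
  refine hasSubst_of_constantCoeff_zero fun s => ?_
  fin_cases s <;> simp [toricChart, hn.ne', hm.ne']

theorem hasSubst_translation {m : ℕ} (hm : 0 < m) (B : K) : HasSubst (translation m B) := by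
  refine hasSubst_of_constantCoeff_zero fun s => ?_
  fin_cases s <;> simp [translation, hm.ne']

theorem prod_toricChart (n m a b : ℕ) (α : K) (d : Fin 2 →₀ ℕ) :
    (d.prod fun s e => toricChart n m a b α s ^ e) =
      X 0 ^ (n * d 0 + m * d 1) * (X 1 + C α) ^ (a * d 0 + b * d 1) := by
  rw [Finsupp.prod_fintype _ _ (by simp), Fin.prod_univ_two]
  simp only [toricChart, Matrix.cons_val_zero, Matrix.cons_val_one]
  ring

theorem constantCoeff_subst_ne_zero {a : Fin 2 → Ser K} (ha : HasSubst a) {u : Ser K}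
    (hu : constantCoeff u ≠ 0) : constantCoeff (subst a u) ≠ 0 := by
  have h : IsUnit u := isUnit_iff_constantCoeff.2 hu.isUnit
  have := (h.map (substAlgHom ha)).map (constantCoeff (σ := Fin 2) (R := K))
  rw [substAlgHom_apply] at this
  exact this.ne_zero

theorem X_pow_dvd_subst_toricChart {n m : ℕ} (hn : 0 < n) (hm : 0 < m) (a b : ℕ) (α : K)
    {N : ℕ} {f : Ser K} (hf : ∀ d, coeff d f ≠ 0 → N ≤ n * d 0 + m * d 1) :
    X 0 ^ N ∣ subst (toricChart n m a b α) f := by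
  rw [X_pow_dvd_iff]
  intro e he
  rw [coeff_subst (hasSubst_toricChart hn hm a b α), finsum_eq_zero_of_forall_eq_zero]
  intro d
  by_cases hd : coeff d f = 0
  · simp [hd]
  · rw [prod_toricChart, coeff_eq_zero_of_X_pow_dvd (Dvd.intro _ rfl) e
      (he.trans_le (hf d hd)), smul_zero]

/-- The polynomial of the terms of weight `n * c` of a series, the weights being `n` and `m`. -/
noncomputable def linePoly (f : Ser K) (n m c : ℕ) : Polynomial K :=
  ∑ k ∈ Finset.range (c / m + 1),
    Polynomial.C (coeff (mon (c - m * k) (n * k)) f) * Polynomial.X ^ k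

theorem exists_line_index {n m c i j : ℕ} (hn : 0 < n) (hm : 0 < m) (hnm : n.Coprime m)
    (h : n * i + m * j = n * c) : ∃ k ∈ Finset.range (c / m + 1), i = c - m * k ∧ j = n * k := by
  have hd : n ∣ j := by
    refine hnm.dvd_of_dvd_mul_left ((Nat.dvd_add_right (Dvd.intro i rfl)).1 ?_)
    exact h ▸ Dvd.intro c rfl
  obtain ⟨k, rfl⟩ := hd
  have h1 : i + m * k = c := Nat.eq_of_mul_eq_mul_left hn (by rw [← h]; ring)
  refine ⟨k, ?_, by omega, rfl⟩
  rw [Finset.mem_range, Nat.lt_succ_iff, Nat.le_div_iff_mul_le hm]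
  nlinarith

theorem mul_le_of_mem_range {c m k : ℕ} (hk : k ∈ Finset.range (c / m + 1)) : m * k ≤ c :=
  (Nat.mul_le_mul_left m (Nat.lt_succ_iff.1 (Finset.mem_range.1 hk))).trans (Nat.mul_div_le c m)

/-- Since `b * n = a * m + 1`, the `k`-th monomial on the line of weight `n * c` becomes `x₁ ^ (n *
c) * (y₁ + α) ^ (a * c + k)`. All remaining terms have larger weight and go into `X 0 * h`. -/
theorem subst_toricChart_eq {n m c : ℕ} (hn : 0 < n) (hm : 0 < m) (hnm : n.Coprime m)
    {a b : ℕ} (hab : b * n = a * m + 1) (α : K) {f : Ser K}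
    (hf : ∀ i j, coeff (mon i j) f ≠ 0 → n * c ≤ n * i + m * j) :
    ∃ h : Ser K, subst (toricChart n m a b α) f = X 0 ^ (n * c) *
      ((X 1 + C α) ^ (a * c) * Polynomial.aeval (X 1 + C α : Ser K) (linePoly f n m c) +
        X 0 * h) := by
  classical
  have hs := hasSubst_toricChart hn hm a b α
  set L : Ser K := ∑ k ∈ Finset.range (c / m + 1),
    monomial (mon (c - m * k) (n * k)) (coeff (mon (c - m * k) (n * k)) f) with hL
  have hrest : X 0 ^ (n * c + 1) ∣ subst (toricChart n m a b α) (f - L) := by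
    refine X_pow_dvd_subst_toricChart hn hm a b α fun d hd => ?_
    by_contra! hlt
    apply hd
    rw [map_sub, sub_eq_zero, hL, map_sum]
    rcases (Nat.lt_succ_iff.1 hlt).lt_or_eq with h | h
    -- Below the line both coefficients vanish: `f` has no such term, and every monomial of `L` has
    -- weight exactly `n * c`.
    · have h0 : coeff d f = 0 := by
        by_contra h0
        rw [← mon_eta d] at h0
        exact absurd (hf _ _ h0) (by omega)
      rw [h0, Finset.sum_eq_zero]
      intro k hk
      rw [coeff_monomial, if_neg]
      rintro rfl
      have := mul_le_of_mem_range hk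
      simp only [mon_zero, mon_one] at h
      obtain ⟨r, hr⟩ := Nat.exists_eq_add_of_le this
      rw [hr, Nat.add_sub_cancel_left] at h
      nlinarith
    · obtain ⟨k, hk, hi, hj⟩ := exists_line_index hn hm hnm h
      have hd' : d = mon (c - m * k) (n * k) := by rw [← hi, ← hj, mon_eta]
      rw [Finset.sum_eq_single_of_mem k hk, hd', coeff_monomial_same]
      intro l _ hl
      rw [coeff_monomial, if_neg]
      intro he
      apply hl
      have := congrArg (fun d => d 1) he
      rw [hd'] at this
      simp only [mon_one] at this
      exact (Nat.eq_of_mul_eq_mul_left hn this).symm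
  obtain ⟨h, hh⟩ := hrest
  refine ⟨h, ?_⟩
  have hLs : subst (toricChart n m a b α) L = X 0 ^ (n * c) *
      ((X 1 + C α) ^ (a * c) * Polynomial.aeval (X 1 + C α : Ser K) (linePoly f n m c)) := by
    rw [← substAlgHom_apply hs, hL, map_sum, linePoly, map_sum, Finset.mul_sum, Finset.mul_sum]
    refine Finset.sum_congr rfl fun k hk => ?_
    obtain ⟨r, hr⟩ := Nat.exists_eq_add_of_le (mul_le_of_mem_range hk)
    rw [substAlgHom_monomial, prod_toricChart]
    simp only [mon_zero, mon_one, map_mul, map_pow, Polynomial.aeval_X, Polynomial.aeval_C]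
    have e1 : n * (c - m * k) + m * (n * k) = n * c := by
      rw [hr, Nat.add_sub_cancel_left]; ring
    have e2 : a * (c - m * k) + b * (n * k) = a * c + k := by
      rw [← mul_assoc, hab, hr, Nat.add_sub_cancel_left]; ring
    rw [e1, e2, pow_add]
    ring
  have : subst (toricChart n m a b α) f =
      subst (toricChart n m a b α) (f - L) + subst (toricChart n m a b α) L := by
    rw [← subst_add hs, sub_add_cancel]
  rw [this, hh, hLs]
  ring

/-- The exponent matrix has determinant `±1`, so distinct monomials have distinct images and no
cancellation occurs. The image of the doubly minimal monomial divides all the others. -/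
theorem subst_toricChart_corner {n m a b i₀ j₀ : ℕ} (hn : 0 < n) (hm : 0 < m)
    (hdet : b * n = a * m + 1 ∨ a * m = b * n + 1) {f : Ser K}
    (h₁ : ∀ i j, coeff (mon i j) f ≠ 0 → n * i₀ + m * j₀ ≤ n * i + m * j)
    (h₂ : ∀ i j, coeff (mon i j) f ≠ 0 → a * i₀ + b * j₀ ≤ a * i + b * j)
    (h₀ : coeff (mon i₀ j₀) f ≠ 0) :
    ∃ g : Ser K, subst (toricChart n m a b (0 : K)) f =
      X 0 ^ (n * i₀ + m * j₀) * X 1 ^ (a * i₀ + b * j₀) * g ∧ constantCoeff g ≠ 0 := by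
  classical
  have hs := hasSubst_toricChart hn hm a b (0 : K)
  have hmon : ∀ p q : ℕ, (X 0 ^ p * X 1 ^ q : Ser K) = monomial (mon p q) 1 := by
    intro p q
    rw [X_pow_eq, X_pow_eq, monomial_mul_monomial, mul_one, mon]
  have hcoeff : ∀ e d : Fin 2 →₀ ℕ,
      coeff e (d.prod fun s e => toricChart n m a b (0 : K) s ^ e) =
        if e = mon (n * d 0 + m * d 1) (a * d 0 + b * d 1) then 1 else 0 := by
    intro e d
    rw [prod_toricChart, map_zero (C (σ := Fin 2) (R := K)), add_zero, hmon, coeff_monomial]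
  set F := subst (toricChart n m a b (0 : K)) f with hF
  set ω := mon (n * i₀ + m * j₀) (a * i₀ + b * j₀) with hω
  obtain ⟨G, hG⟩ : ∃ G : Ser K, ∀ e, coeff e G = coeff (ω + e) F :=
    ⟨fun e => coeff (ω + e) F, fun _ => rfl⟩
  refine ⟨G, ?_, ?_⟩
  · rw [hmon]
    ext e
    rw [coeff_monomial_mul]
    split_ifs with he
    · rw [one_mul, hG, hω, add_tsub_cancel_of_le he]
    · rw [hF, coeff_subst hs, finsum_eq_zero_of_forall_eq_zero]
      intro d
      rw [hcoeff]
      by_cases hd : coeff d f = 0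
      · rw [hd, zero_smul]
      · rw [if_neg, smul_zero]
        rintro rfl
        rw [← mon_eta d] at hd
        apply he
        intro s
        fin_cases s
        · simpa [hω] using h₁ _ _ hd
        · simpa [hω] using h₂ _ _ hd
  · rw [← coeff_zero_eq_constantCoeff_apply, hG, add_zero, hF, coeff_subst hs, finsum_eq_single _ (mon i₀ j₀)]
    · rw [hcoeff, if_pos (by simp [hω]), smul_eq_mul, mul_one]
      exact h₀
    · intro d hd
      rw [hcoeff, if_neg, smul_zero]
      intro he
      apply hd
      have e1 : n * i₀ + m * j₀ = n * d 0 + m * d 1 := by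
        simpa [hω] using congrArg (fun d => d 0) he
      have e2 : a * i₀ + b * j₀ = a * d 0 + b * d 1 := by
        simpa [hω] using congrArg (fun d => d 1) he
      rw [← mon_eta d]
      -- Cramer's rule for a matrix of determinant `±1`.
      zify at e1 e2 hdet
      have hi : (d 0 : ℤ) = i₀ := by
        rcases hdet with h | h
        · linear_combination (-(b : ℤ)) * e1 + m * e2 - (d 0 - i₀ : ℤ) * h
        · linear_combination (b : ℤ) * e1 - m * e2 - (d 0 - i₀ : ℤ) * h
      have hj : (d 1 : ℤ) = j₀ := by
        rcases hdet with h | h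
        · linear_combination (a : ℤ) * e1 - n * e2 - (d 1 - j₀ : ℤ) * h
        · linear_combination (-(a : ℤ)) * e1 + n * e2 - (d 1 - j₀ : ℤ) * h
      rw [Nat.cast_injective hi, Nat.cast_injective hj]

/-! ### Coefficients of a pencil and of its members -/

namespace Pencil

theorem A_eq (P : Pencil K) (i j : ℕ) : P.A i j = Polynomial.C (coeff (mon i j) P.p) -
    Polynomial.X * Polynomial.C (coeff (mon i j) (X 0 ^ P.c * P.U)) := by
  rw [A, series, map_sub, coeff_C_mul, coeff_map, coeff_map]

theorem coeff_fiber (P : Pencil K) (t : K) (i j : ℕ) :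
    coeff (mon i j) (P.fiber t) = (P.A i j).eval t := by
  rw [A_eq, fiber, map_sub, coeff_C_mul]
  simp [mul_comm t]

theorem coeff_X_pow_mul_U_eq_zero (P : Pencil K) {i : ℕ} (j : ℕ) (hi : i < P.c) :
    coeff (mon i j) (X 0 ^ P.c * P.U) = 0 :=
  coeff_eq_zero_of_X_pow_dvd (Dvd.intro _ rfl) _ (by simpa using hi)

theorem coeff_X_pow_mul_U (P : Pencil K) :
    coeff (mon P.c 0) (X 0 ^ P.c * P.U) = constantCoeff P.U := by
  have h : mon P.c 0 = Finsupp.single 0 P.c + 0 := by simp [mon]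
  rw [h, X_pow_eq, coeff_add_monomial_mul, one_mul, coeff_zero_eq_constantCoeff_apply]

theorem A_c_zero_ne_zero (P : Pencil K) (hU : constantCoeff P.U ≠ 0) : P.A P.c 0 ≠ 0 := by
  intro h
  have := congrArg (fun q => Polynomial.coeff q 1) h
  rw [A_eq, coeff_X_pow_mul_U] at this
  simp [Polynomial.coeff_C] at this
  exact hU this

theorem A_ne_zero_of_coeff_fiber_ne_zero (P : Pencil K) (t : K) {i j : ℕ}
    (h : coeff (mon i j) (P.fiber t) ≠ 0) : P.A i j ≠ 0 := by
  rintro h0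
  rw [coeff_fiber, h0, Polynomial.eval_zero] at h
  exact h rfl

theorem coeff_fiber_ne_zero_of_lt (P : Pencil K) (t : K) {i j : ℕ} (hi : i < P.c)
    (h : P.A i j ≠ 0) : coeff (mon i j) (P.fiber t) ≠ 0 := by
  rw [coeff_fiber]
  rw [A_eq, coeff_X_pow_mul_U_eq_zero P j hi] at h ⊢
  simpa using h

theorem subst_fiber {a : Fin 2 → Ser K} (ha : HasSubst a) (P : Pencil K) (t : K) :
    subst a (P.fiber t) = subst a P.p - C t * subst a (X 0 ^ P.c * P.U) := by
  rw [fiber, subst_sub ha, subst_mul ha, subst_C]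

theorem eval_zero_edgePoly (P : Pencil K) (n m i₀ j₀ : ℕ) :
    (P.edgePoly n m i₀ j₀).eval 0 = P.A i₀ j₀ := by
  rw [edgePoly, Polynomial.eval_finsetSum, Finset.sum_eq_single_of_mem 0 (by simp)]
  · simp
  · intro k _ hk
    simp [hk]

end Pencil

/-! ### Members of the pencil along the process -/

/-- In a toric step `α ≠ 0`, so the powers of `y₁ + α` are units and only powers of `x₁` split off.
Positivity of `c` and invertibility of `U` are carried along to keep the induction going. -/
theorem Reaches.fiber_eq {P₀ P : Pencil K} {π : Ser K → Ser K} (h : Reaches P₀ P π)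
    (hP₀ : P₀.IsSpecial) : 0 < P.c ∧ constantCoeff P.U ≠ 0 ∧ ∀ t, ∃ (N : ℕ) (u : Ser K),
      constantCoeff u ≠ 0 ∧ π (P₀.fiber t) = X 0 ^ N * u * P.fiber t := by
  induction h with
  | start =>
    exact ⟨hP₀.1, (isUnit_iff_constantCoeff.1 hP₀.2.1).ne_zero, fun t => ⟨0, 1, by simp, by simp⟩⟩
  | @translate P π _ n m i₀ j₀ e B hedge hpure ih =>
    obtain ⟨hc, hU, hfib⟩ := ih
    have hs := hasSubst_translation hedge.2.1 B
    refine ⟨hc, constantCoeff_subst_ne_zero hs hU, fun t => ?_⟩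
    obtain ⟨N, u, hu, he⟩ := hfib t
    refine ⟨N, subst (translation m B) u, constantCoeff_subst_ne_zero hs hu, ?_⟩
    beta_reduce
    rw [he, subst_mul hs, subst_mul hs, subst_pow hs, subst_X hs, Pencil.subst_fiber hs,
      subst_mul hs, subst_pow hs, subst_X hs]
    rfl
  | @toric P P' π _ n m i₀ j₀ a b α hedge hdic hpure ha hb hab hroot htr ih =>
    obtain ⟨hc, hU, hfib⟩ := ih
    obtain ⟨hn, hm, -, ⟨hA, hmin⟩, hlow, -⟩ := hedge
    obtain ⟨hp, hcU, hcc⟩ := htr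
    have hs := hasSubst_toricChart hn hm a b α
    -- The constant term of the edge polynomial is the coefficient at the lower right vertex, which
    -- is nonzero.
    have hα : α ≠ 0 := by
      rintro rfl
      rw [map_zero, Pencil.eval_zero_edgePoly] at hroot
      exact hA hroot
    have hw : ∀ k : ℕ, constantCoeff ((X 1 + C α : Ser K) ^ k) ≠ 0 := by
      intro k; simpa using pow_ne_zero k hα
    -- If the new exponent were `0`, then `(P.c, 0)` would lie on the edge and be its lower right
    -- vertex, making the edge dicritical.
    have hc' : 0 < P'.c := by
      by_contra h0
      have := hmin P.c 0 (P.A_c_zero_ne_zero hU)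
      have hωc : n * i₀ + m * j₀ = n * P.c := by omega
      have hj : j₀ = 0 := by simpa using hlow P.c 0 (P.A_c_zero_ne_zero hU) (by omega)
      subst hj
      have hi : i₀ = P.c := Nat.eq_of_mul_eq_mul_left hn (by simpa using hωc)
      exact hdic (by rw [hi])
    refine ⟨hc', ?_, fun t => ?_⟩
    · rw [subst_mul hs, subst_pow hs, subst_X hs] at hcU
      have hx : (X 0 : Ser K) ^ (n * P.c) ≠ 0 := by
        intro h0
        simpa [X_pow_eq] using congrArg (coeff (Finsupp.single 0 (n * P.c))) h0
      have he : (X 1 + C α : Ser K) ^ (a * P.c) * subst (toricChart n m a b α) P.U =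
          (X 1 + C α) ^ P.minWeight a b * P'.U := by
        apply mul_left_cancel₀ hx
        calc _ = (X 0 ^ n * (X 1 + C α) ^ a) ^ P.c * subst (toricChart n m a b α) P.U := by ring
          _ = _ := hcU
          _ = X 0 ^ (P'.c + (n * i₀ + m * j₀)) * ((X 1 + C α) ^ P.minWeight a b * P'.U) := by
              ring
          _ = _ := by rw [hcc]
      have := congrArg constantCoeff he
      rw [map_mul, map_mul] at this
      intro h0
      rw [h0, mul_zero] at this
      exact mul_ne_zero (hw _) (constantCoeff_subst_ne_zero hs hU) this
    · obtain ⟨N, u, hu, he⟩ := hfib t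
      refine ⟨n * N + (n * i₀ + m * j₀), (X 1 + C α) ^ (a * N) *
        subst (toricChart n m a b α) u * (X 1 + C α) ^ P.minWeight a b, ?_, ?_⟩
      · rw [map_mul, map_mul]
        exact mul_ne_zero (mul_ne_zero (hw _) (constantCoeff_subst_ne_zero hs hu)) (hw _)
      · beta_reduce
        rw [he, subst_mul hs, subst_mul hs, subst_pow hs, subst_X hs, Pencil.subst_fiber hs,
          hcU, hp, Pencil.fiber]
        simp only [toricChart, Matrix.cons_val_zero]
        ring

/-! ### Local equations at the points of the dicritical divisor -/

namespace Dicritical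

variable {P₀ : Pencil K} (E : Dicritical P₀)

/-- Away from `k = 0` the abscissa `c - m * k` is less than `c`, so `t` only changes the constant
term. -/
theorem linePoly_fiber (hU : constantCoeff E.P.U ≠ 0) (t : K) :
    linePoly (E.P.fiber t) E.n E.m E.P.c =
      Polynomial.C (constantCoeff E.P.U) * (E.q - Polynomial.C t) := by
  have hm : 0 < E.m := E.isEdge.2.1
  have hq : Polynomial.C (constantCoeff E.P.U) * E.q =
      ∑ k ∈ Finset.range (E.P.c / E.m + 1),
        Polynomial.C (coeff (mon (E.P.c - E.m * k) (E.n * k)) E.P.p) * Polynomial.X ^ k := by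
    rw [q, ← mul_assoc, ← Polynomial.C_mul, mul_inv_cancel₀ hU, Polynomial.C_1, one_mul,
      Pencil.edgePoly, Polynomial.map_sum]
    refine Finset.sum_congr rfl fun k _ => ?_
    rw [zero_add, Pencil.A_eq]
    simp
  rw [mul_sub, hq, linePoly, eq_sub_iff_add_eq, ← eq_sub_iff_add_eq',
    ← Finset.sum_sub_distrib, Finset.sum_eq_single_of_mem 0 (by simp)]
  · rw [Pencil.fiber, mul_zero, mul_zero, Nat.sub_zero, map_sub, coeff_C_mul,
      Pencil.coeff_X_pow_mul_U]
    simp [mul_comm t]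
  · intro k hk hk0
    have h1 := mul_le_of_mem_range hk
    have h2 : 0 < E.m * k := Nat.mul_pos hm (Nat.pos_of_ne_zero hk0)
    rw [Pencil.fiber, map_sub, coeff_C_mul,
      Pencil.coeff_X_pow_mul_U_eq_zero E.P _ (by omega : E.P.c - E.m * k < E.P.c)]
    simp

theorem coeff_fiber_c_zero (hU : constantCoeff E.P.U ≠ 0) (t : K) :
    coeff (mon E.P.c 0) (E.P.fiber t) = constantCoeff E.P.U * (E.q.eval 0 - t) := by
  have := congrArg (Polynomial.eval 0) (E.linePoly_fiber hU t)
  rw [linePoly, Polynomial.eval_finsetSum, Finset.sum_eq_single_of_mem 0 (by simp)] at this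
  · simpa using this
  · intro k _ hk
    simp [hk]

theorem weight_le_of_coeff_fiber (t : K) (i j : ℕ)
    (h : coeff (mon i j) (E.P.fiber t) ≠ 0) : E.n * E.P.c ≤ E.n * i + E.m * j := by
  simpa using E.isEdge.2.2.2.1.2 i j (E.P.A_ne_zero_of_coeff_fiber_ne_zero t h)

theorem chart_eq {a b : ℕ} (hab : b * E.n = a * E.m + 1) {α : K} (hα : α ≠ 0 ∨ E.n = 1) :
    ∃ a' b' : ℕ, b' * E.n = a' * E.m + 1 ∧ α ^ a' ≠ 0 ∧
      E.chart a b α = toricChart E.n E.m a' b' α := by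
  by_cases h : α = 0
  · subst h
    -- The exponents `(0, 1)` satisfy the determinant relation because `n = 1`, and `0 ^ 0 = 1`
    -- gives the nonvanishing.
    refine ⟨0, 1, ?_, by simp, by simp [chart]⟩
    simpa using hα
  · exact ⟨a, b, hab, pow_ne_zero _ h, by simp [chart, h]⟩

theorem subst_chart_fiber_eq (hP₀ : P₀.IsSpecial) (t : K) {a b : ℕ}
    (hab : b * E.n = a * E.m + 1) {α : K} (hα : α ≠ 0 ∨ E.n = 1) :
    ∃ (N : ℕ) (v g h : Ser K), constantCoeff v ≠ 0 ∧
      subst (E.chart a b α) (E.π (P₀.fiber t)) = X 0 ^ N * g ∧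
      g = v * Polynomial.aeval (X 1 + C α : Ser K) (E.q - Polynomial.C t) + X 0 * h := by
  obtain ⟨-, hU, hfib⟩ := E.process.fiber_eq hP₀
  obtain ⟨N, u, hu, he⟩ := hfib t
  obtain ⟨a', b', hab', hα', hchart⟩ := E.chart_eq hab hα
  obtain ⟨hn, hm, hnm, -⟩ := E.isEdge
  have hs := hasSubst_toricChart hn hm a' b' α
  obtain ⟨h, hh⟩ := subst_toricChart_eq hn hm hnm hab' α (E.weight_le_of_coeff_fiber t)
  rw [E.linePoly_fiber hU, map_mul, Polynomial.aeval_C] at hh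
  set w : Ser K := X 1 + C α with hw
  have hw0 : ∀ k, constantCoeff (w ^ (a' * k)) ≠ 0 := by
    intro k
    simpa [hw, pow_mul] using pow_ne_zero k hα'
  refine ⟨E.n * N + E.n * E.P.c, w ^ (a' * N) * subst (toricChart E.n E.m a' b' α) u *
    w ^ (a' * E.P.c) * C (constantCoeff E.P.U), _,
    w ^ (a' * N) * subst (toricChart E.n E.m a' b' α) u * h, ?_, ?_, rfl⟩
  · simp only [map_mul, constantCoeff_C]
    exact mul_ne_zero (mul_ne_zero (mul_ne_zero (hw0 _)
      (constantCoeff_subst_ne_zero hs hu)) (hw0 _)) hU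
  · rw [hchart, he, subst_mul hs, subst_mul hs, subst_pow hs, subst_X hs, hh]
    simp only [toricChart, Matrix.cons_val_zero, ← hw, MvPowerSeries.algebraMap_apply, Algebra.algebraMap_self,
      RingHom.id_apply]
    ring

theorem constantCoeff_aeval (α : K) (Q : Polynomial K) :
    constantCoeff (Polynomial.aeval (X 1 + C α : Ser K) Q) = Q.eval α := by
  have h : (constantCoeff (σ := Fin 2) (R := K)).comp (algebraMap K (Ser K)) = RingHom.id K := by
    ext x; simp [MvPowerSeries.algebraMap_apply]
  rw [Polynomial.aeval_def, Polynomial.hom_eval₂, h]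
  simp [Polynomial.eval, Polynomial.eval₂_eq_sum_range]

/-- Write `Q = (X - α) * R`: both sides equal `R(α)`. -/
theorem coeff_aeval {α : K} {Q : Polynomial K} (h : Q.eval α = 0) :
    coeff (mon 0 1) (Polynomial.aeval (X 1 + C α : Ser K) Q) = Q.derivative.eval α := by
  obtain ⟨R, rfl⟩ := Polynomial.dvd_iff_isRoot.2 h
  have h1 : Polynomial.aeval (X 1 + C α : Ser K) (Polynomial.X - Polynomial.C α) = X 1 := by
    simp [MvPowerSeries.algebraMap_apply]
  rw [map_mul, h1, mul_comm, coeff_mon_zero_one_mul _ _ (by simp), constantCoeff_aeval]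
  simp [mon, coeff_X]

theorem exists_curvette (hP₀ : P₀.IsSpecial) {t : K} {a b : ℕ}
    (hab : b * E.n = a * E.m + 1) {α : K} (hα : α ≠ 0 ∨ E.n = 1) (hq : E.q.eval α = t)
    (hq' : E.q.derivative.eval α ≠ 0) :
    ∃ g, E.IsStrictTransform a b α (P₀.fiber t) g ∧ IsCurvette g := by
  obtain ⟨N, v, g, h, hv, hg, rfl⟩ := E.subst_chart_fiber_eq hP₀ t hab hα
  have hQ : (E.q - Polynomial.C t).eval α = 0 := by simp [hq]
  have h0 : constantCoeff (Polynomial.aeval (X 1 + C α : Ser K) (E.q - Polynomial.C t)) = 0 := by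
    rw [constantCoeff_aeval, hQ]
  have hX : coeff (mon 0 1) (X 0 * h) = 0 :=
    X_dvd_iff.1 (Dvd.intro h rfl) _ (mon_zero 0 1)
  have h1 : coeff (mon 0 1) (v * Polynomial.aeval (X 1 + C α : Ser K) (E.q - Polynomial.C t) +
      X 0 * h) ≠ 0 := by
    rw [map_add, hX, add_zero, coeff_mon_zero_one_mul _ _ h0, coeff_aeval hQ]
    refine mul_ne_zero hv ?_
    simpa using hq'
  refine ⟨_, ⟨N, hg, not_X_zero_dvd_of_coeff_ne_zero h1⟩, ⟨?_, Or.inr h1⟩, h1⟩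
  rw [map_add, map_mul, map_mul, h0]
  simp

theorem exists_unit (hP₀ : P₀.IsSpecial) {t : K} {a b : ℕ}
    (hab : b * E.n = a * E.m + 1) {α : K} (hα : α ≠ 0 ∨ E.n = 1) (hq : E.q.eval α ≠ t) :
    ∃ g, E.IsStrictTransform a b α (P₀.fiber t) g ∧ constantCoeff g ≠ 0 := by
  obtain ⟨N, v, g, h, hv, hg, rfl⟩ := E.subst_chart_fiber_eq hP₀ t hab hα
  have h0 : constantCoeff (v * Polynomial.aeval (X 1 + C α : Ser K) (E.q - Polynomial.C t) +
      X 0 * h) ≠ 0 := by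
    rw [map_add, map_mul, map_mul, constantCoeff_aeval]
    simpa [sub_eq_zero] using ⟨hv, hq⟩
  exact ⟨_, ⟨N, hg, not_X_dvd_of_constantCoeff_ne_zero h0 0⟩, h0⟩

theorem exists_cornerTransform (hP₀ : P₀.IsSpecial) {t : K} {a b : ℕ}
    (hab : E.IsCorner a b) (ht : E.n ≠ 1 → E.q.eval 0 ≠ t) :
    ∃ g, E.IsCornerTransform a b (P₀.fiber t) g ∧ constantCoeff g ≠ 0 := by
  obtain ⟨-, hU, hfib⟩ := E.process.fiber_eq hP₀
  obtain ⟨N, u, hu, he⟩ := hfib t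
  obtain ⟨hn, hm, hnm, ⟨hA, hmin⟩, -, i', j', hA', hline', hne'⟩ := E.isEdge
  obtain ⟨hdet, i, j, h₁, h₂⟩ := hab
  have hs := hasSubst_toricChart hn hm a b (0 : K)
  have hline : E.n * i + E.m * j = E.n * E.P.c := by
    have := h₁.2 _ _ hA
    have := hmin _ _ h₁.1
    omega
  have key : coeff (mon i j) (E.P.fiber t) ≠ 0 := by
    rcases hdet with ⟨hn1, hdet⟩ | hdet
    -- Corner `z = 0`: on the line, `n * (a * i + b * j) = n * a * c + j`, so the weight `(a, b)` is
    -- least at `j = 0`, that is, at `(c, 0)`.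
    · have hle := h₂.2 _ _ hA
      have hj : j = 0 := by
        by_contra hj
        have : 0 < j := Nat.pos_of_ne_zero hj
        zify at hle hdet hline this
        have e : (E.n : ℤ) * (a * i + b * j) - E.n * (a * E.P.c) = j := by
          linear_combination a * hline + j * hdet
        have hn' : (0 : ℤ) < E.n := by exact_mod_cast hn
        nlinarith
      subst hj
      have hi : i = E.P.c := Nat.eq_of_mul_eq_mul_left hn (by simpa using hline)
      subst hi
      rw [E.coeff_fiber_c_zero hU]
      exact mul_ne_zero hU (sub_ne_zero.2 (ht hn1))
    -- Corner `z = ∞`: now `n * (a * i + b * j) = n * a * c - j` on the line. Hence `(c, 0)` is not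
    -- minimal, as the edge has a second point `(i', j')` with `j' > 0`.
    · refine E.P.coeff_fiber_ne_zero_of_lt t ?_ h₁.1
      by_contra! hci
      have hj : j = 0 := by
        by_contra hj
        have := Nat.mul_pos hm (Nat.pos_of_ne_zero hj)
        have := Nat.mul_le_mul_left E.n hci
        omega
      subst hj
      have hi : i = E.P.c := Nat.eq_of_mul_eq_mul_left hn (by simpa using hline)
      subst hi
      have hle := h₂.2 _ _ hA'
      have hj' : j' = 0 := by
        by_contra hj
        have : 0 < j' := Nat.pos_of_ne_zero hj
        zify at hle hdet hline' this
        have e : (E.n : ℤ) * (a * i' + b * j') - E.n * (a * E.P.c) = -j' := by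
          linear_combination a * hline' - j' * hdet
        have hn' : (0 : ℤ) < E.n := by exact_mod_cast hn
        nlinarith
      subst hj'
      have hi : i' = E.P.c := Nat.eq_of_mul_eq_mul_left hn (by simpa using hline')
      exact hne' (by rw [hi])
  obtain ⟨g, hg, hg0⟩ := subst_toricChart_corner hn hm (hdet.imp_left And.right)
    (fun k l h => h₁.2 k l (E.P.A_ne_zero_of_coeff_fiber_ne_zero t h))
    (fun k l h => h₂.2 k l (E.P.A_ne_zero_of_coeff_fiber_ne_zero t h)) key
  have h0 : constantCoeff (subst (toricChart E.n E.m a b (0 : K)) u * g) ≠ 0 := by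
    rw [map_mul]
    exact mul_ne_zero (constantCoeff_subst_ne_zero hs hu) hg0
  refine ⟨_, ⟨E.n * N + (E.n * i + E.m * j), a * N + (a * i + b * j), ?_,
    not_X_dvd_of_constantCoeff_ne_zero h0 0, not_X_dvd_of_constantCoeff_ne_zero h0 1⟩, h0⟩
  rw [he, subst_mul hs, subst_mul hs, subst_pow hs, subst_X hs, hg]
  simp only [toricChart, Matrix.cons_val_zero, map_zero (C (σ := Fin 2) (R := K)), add_zero]
  ring

end Dicritical

/-! ### Counting the points and conclusion -/

theorem card_roots_toFinset_sub_C [IsAlgClosed K] [DecidableEq K] {q : Polynomial K} {t : K}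
    (ht : ∀ α, q.eval α = t → q.derivative.eval α ≠ 0) :
    (q - Polynomial.C t).roots.toFinset.card = q.natDegree := by
  rw [Multiset.toFinset_card_of_nodup, ← Polynomial.natDegree_sub_C (p := q) (a := t)]
  · exact (Polynomial.splits_iff_card_roots.1 (IsAlgClosed.splits _))
  · rw [Multiset.nodup_iff_count_le_one]
    intro α
    rw [Polynomial.count_roots]
    by_contra! h
    -- The zero polynomial has root multiplicity `0` by convention, against `h`.
    have h0 : q - Polynomial.C t ≠ 0 := by
      intro h0
      rw [h0, Polynomial.rootMultiplicity_zero] at h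
      omega
    obtain ⟨h1, h2⟩ := (Polynomial.one_lt_rootMultiplicity_iff_isRoot h0).1 h
    refine ht α (sub_eq_zero.1 (by simpa using h1)) (by simpa using h2)

end ToricNewton

theorem mainTheorem3 {K : Type*} [Field K] [IsAlgClosed K]
    (P₀ : ToricNewton.Pencil K) (hP₀ : P₀.IsSpecial) (E : ToricNewton.Dicritical P₀)
    (hsep : Polynomial.derivative E.q ≠ 0) (t : K)
    (ht : (t ∉ E.criticalValues ∧ t ≠ E.q.eval 0) ∨
      (t = E.q.eval 0 ∧ t ∉ E.criticalValues ∧ E.n = 1)) :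
    ∃ S : Finset K, S.card = E.q.natDegree ∧ (∀ α ∈ S, α ≠ 0 ∨ E.n = 1) ∧
      (∀ a b : ℕ, 0 < a → 0 < b → b * E.n = a * E.m + 1 →
        (∀ α ∈ S, ∃ g, E.IsStrictTransform a b α (P₀.fiber t) g ∧ ToricNewton.IsCurvette g) ∧
        (∀ α ∉ S, (α ≠ 0 ∨ E.n = 1) →
          ∃ g, E.IsStrictTransform a b α (P₀.fiber t) g ∧
            MvPowerSeries.constantCoeff g ≠ 0)) ∧
      (∀ a b : ℕ, E.IsCorner a b →
        ∃ g, E.IsCornerTransform a b (P₀.fiber t) g ∧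
          MvPowerSeries.constantCoeff g ≠ 0) := by
  classical
  have hcrit : ∀ α, E.q.eval α = t → E.q.derivative.eval α ≠ 0 := fun α hα hα' =>
    (ht.elim And.left fun h => h.2.1) ⟨α, hα', hα⟩
  have hzero : E.n ≠ 1 → E.q.eval 0 ≠ t := fun hn =>
    ht.elim (fun h => h.2.symm) fun h => absurd h.2.2 hn
  have hq : E.q - Polynomial.C t ≠ 0 := by
    intro h
    rw [sub_eq_zero.1 h, Polynomial.derivative_C] at hsep
    exact hsep rfl
  have hmem : ∀ α, α ∈ (E.q - Polynomial.C t).roots.toFinset ↔ E.q.eval α = t := fun α => by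
    simp [Polynomial.mem_roots hq, sub_eq_zero]
  have hS : ∀ α ∈ (E.q - Polynomial.C t).roots.toFinset, α ≠ 0 ∨ E.n = 1 := by
    intro α hα
    by_contra! h
    exact hzero h.2 (h.1 ▸ (hmem α).1 hα)
  refine ⟨_, ToricNewton.card_roots_toFinset_sub_C hcrit, hS, fun a b _ _ hab => ⟨?_, ?_⟩, ?_⟩
  · exact fun α hα => E.exists_curvette hP₀ hab (hS α hα) ((hmem α).1 hα)
      (hcrit α ((hmem α).1 hα))
  · exact fun α hα hα' => E.exists_unit hP₀ hab hα' fun h => hα ((hmem α).2 h)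
  · exact fun a b hab => E.exists_cornerTransform hP₀ hab hzero
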